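/- **Process box description of QC-QCs.** *Setting.* All Hilbert spaces are finite dimensional with fixed orthonormal bases. $|V\rangle\rangle=\sum_x|x\rangle\otimes V|x\rangle$ is the Choi vector of $V$, and $*$ is the link product of vectors (contraction, without complex conjugation, over the shared tensor factors). Let $N\ge 1$, $\mathcal N=\{1,\dots,N\}$; agent $k$ has input and output spaces $\mathcal H^{A^I_k},\mathcal H^{A^O_k}$; $P$, $F$ are the global past and the global future ($F$ includes any purifying ancilla); $\alpha_1,\dots,\alpha_N$ are ancillas. In sums below $K\subset\mathcal N$, $|K|=n-1$, $k\in\mathcal N\setminus K$ and $k'\in\mathcal N\setminus(K\cup k)$. *QC-QC.* An $N$-partite QC-QC is given by linear maps $V^{\to k}_{\emptyset,\emptyset}:\mathcal H^P\to\mathcal H^{A^I_k\alpha_1}$, $V^{\to k'}_{K,k}:\mathcal H^{A^O_k\alpha_n}\to\mathcal H^{A^I_{k'}\alpha_{n+1}}$ for $1\le n<N$, and $V^{\to F}_{\mathcal N\setminus k,k}:\mathcal H^{A^O_k\alpha_N}\to\mathcal H^F$, such that, with orthonormal control states $|K,k\rangle$, the operators $$V_1=\sum_k V^{\to k}_{\emptyset,\emptyset}\otimes|\emptyset,k\rangle,\quad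 V_{n+1}=\sum_{K,k,k'}V^{\to k'}_{K,k}\otimes|K\cup k,k'\rangle\langle K,k|,\quad V_{N+1}=\sum_kV^{\to F}_{\mathcal N\setminus k,k}\otimes\langle\mathcal N\setminus k,k|$$ are isometries. Its process vector is $$|w_{\mathcal N,F}\rangle=\sum_{(k_1,\dots,k_N)}|V^{\to k_1}_{\emptyset,\emptyset}\rangle\rangle*|V^{\to k_2}_{\emptyset,k_1}\rangle\rangle*\cdots*|V^{\to F}_{\mathcal N\setminus k_N,k_N}\rangle\rangle ,$$ the sum running over all orders of the agents and the link products contracting the ancillas. *The box.* Positions are $1,\dots,2N+2$. At position $2n$ (resp. $2n+1$), $1\le n\le N$, agent $k$ has an input (resp. output) wire. A message on it is a vector of $\mathcal H^{A^I_k\alpha_n}$ (resp. $\mathcal H^{A^O_k\alpha_n}$) tensored with the time stamp $|t\rangle$ of the position and with a control state $|K,k\rangle$, $|K|=n-1$, $k\notin K$; the past sends one message at $t=1$, the future receives at $t=2N+2$. The boxes send into the symmetric Fock space of each input wire, and receive zero (vacuum $\Omega$) or one message on each output wire. Define $$\bar V_1|\psi,t=1\rangle=V_1|\psi\rangle\,|t=2\rangle,\qquad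 \bar V_{n+1}\Big(\bigotimes_{k\in S}|\psi^k,t=2n+1\rangle|K^k,k\rangle\Big)=\mathrm{symm}\Big(\bigotimes_{k\in S}V_{n+1}(|\psi^k\rangle|K^k,k\rangle)\,|t=2n+2\rangle\Big)$$ for $1\le n\le N$ and every $S\subseteq\mathcal N$, where wires outside $S$ carry the vacuum (for $S=\emptyset$, vacuum goes to vacuum), and extend linearly. Here $\mathrm{symm}$ expands the tensor product into the distributions of the messages over the receiving wires and replaces the tensor product of the messages on each wire by $\bigodot_{i=1}^r\phi_i=\frac1{\sqrt{r!}}\sum_{\pi\in S_r}\bigotimes_i\phi_{\pi(i)}$. *Local operations.* A local operation $A_k:\mathcal H^{A^I_k}\to\mathcal H^{A^O_k}$ of the QC-QC and $\bar A_k$ of the box are operationally equivalent if $\bar A_k=\bigotimes_{t\in\{2,4,\dots,2N\}}\big(A_k\otimes\mathbb 1\otimes|t+1\rangle\langle t|+|\Omega,t+1\rangle\langle\Omega,t|\big)$, where $\mathbb 1$ acts on ancilla and control. The effective Choi vector $|\bar V\rangle\rangle$ of the box is the Choi vector of $\bar V_1,\dots,\bar V_{N+1}$ projected on the span of the basis states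 in which the past sends and the future receives one message and, for each agent $k$, there is a $t$ such that all input wires except that at $t$ and all output wires except that at $t+1$ carry the vacuum, and the output at $t+1$ is the vacuum if the input at $t$ is. **Proposition.** The maps $\bar V_1,\dots,\bar V_{N+1}$ are isometries, so they are the sequence representation of a causal box. It is a process box: when it is composed with local operations that map vacuum to vacuum and a message at $t$ to a message at $t+1$, acting trivially on ancilla and control, each agent receives exactly one message during the entire run, in every basis history of non-zero amplitude. It is operationally equivalent to the QC-QC: there are unitaries $U_P:\mathcal H^P\to\mathcal H^P\otimes|t=1\rangle$ and $U_F:\mathcal H^F\to\mathcal H^F\otimes|t=2N+2\rangle$ such that for all local operations $A_1,\dots,A_N$ and all $\bar A_1,\dots,\bar A_N$ with $\bar A_k$ operationally equivalent to $A_k$ for every $k$, $$(U_P\otimes U_F)\big((|A_1\rangle\rangle\otimes\cdots\otimes|A_N\rangle\rangle)*|w_{\mathcal N,F}\rangle\big)=(|\bar A_1\rangle\rangle\otimes\cdots\otimes|\bar A_N\rangle\rangle)*|\bar V\rangle\rangle .$$ -/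

import Mathlib

open scoped Kronecker

namespace QCPB

/-!
All Hilbert spaces are finite dimensional with a fixed orthonormal (computational) basis: the space
with basis indexed by a finite type `X` is `ℂ^X`, operators are matrices, vectors of tensor products
are functions on product index types.
-/

/-- The Choi vector `|V⟩⟩ = ∑ₓ |x⟩ ⊗ V|x⟩` of an operator `V : ℂ^X → ℂ^Y`. -/
def choiVec {X Y : Type} (V : Matrix Y X ℂ) : X × Y → ℂ := fun z => V z.2 z.1

/-- The link product `a * b` of `a ∈ H^Y` and `b ∈ H^{YZ}`: contraction over the shared space `Y`. -/
def link {Y Z : Type} [Fintype Y] (a : Y → ℂ) (b : Y × Z → ℂ) : Z → ℂ :=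
  fun z => ∑ y, a y * b (y, z)

/-- The tensor product of the Choi vectors of a family of operators `V k : ℂ^{X k} → ℂ^{Y k}`. -/
def tensorChoi {N : ℕ} {X Y : Fin N → Type} (V : ∀ k, Matrix (Y k) (X k) ℂ) :
    (∀ k, X k × Y k) → ℂ :=
  fun z => ∏ k, choiVec (V k) (z k)

/-- The matrix `U` is unitary: `U†U = 1` and `UU† = 1`. -/
def IsUnitary {X Y : Type} [Fintype X] [Fintype Y] [DecidableEq X] [DecidableEq Y]
    (U : Matrix Y X ℂ) : Prop :=
  U.conjTranspose * U = 1 ∧ U * U.conjTranspose = 1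

/-! ### Fock spaces -/

/-- Basis of the space `H^X ⊗ |t⟩` of messages `|x, t⟩` with position label `t`. -/
abbrev Msg (X : Type) (t : ℕ) : Type := X × {s : ℕ // s = t}

/-- Words over `X`: the product basis of `⨁ₙ (ℂ^X)^{⊗n}`. -/
abbrev Word (X : Type) : Type := Σ n : ℕ, (Fin n → X)

/-- A state with zero (`none`, the vacuum `Ω`) or one message as a word. -/
def wordOf {X : Type} : Option X → Word X
  | none => ⟨0, Fin.elim0⟩
  | some x => ⟨1, fun _ => x⟩

/-- The tensor product `⨂_w F(ℂ^{X w})` over wires `w ∈ W` of the symmetric Fock spaces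
`F(H) = ⨁ₙ ∨ⁿ H`, realised as the square-summable coefficient families on words that are
invariant under permuting the tensor factors of each wire, with the inherited inner product. -/
def Fock {W : Type} (X : W → Type) :
    Submodule ℂ (lp (fun _ : (∀ w, Word (X w)) => ℂ) 2) where
  carrier := {f | ∀ (l : ∀ w, Word (X w)) (σ : ∀ w, Equiv.Perm (Fin (l w).1)),
    f (fun w => ⟨(l w).1, (l w).2 ∘ σ w⟩) = f l}
  add_mem' := by
    intro f g hf hg l σ
    have h1 := hf l σ
    have h2 := hg l σ
    simp only [lp.coeFn_add, Pi.add_apply]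
    rw [h1, h2]
  zero_mem' := by
    intro l σ
    simp
  smul_mem' := by
    intro c f hf l σ
    have h1 := hf l σ
    simp only [lp.coeFn_smul, Pi.smul_apply]
    rw [h1]

/-- The symmetric tensor product `⨀_{s ∈ S} ψ_s = (n!)^{-1/2} ∑_π ⨂_i ψ_{π(i)}`, `n = |S|`
(the coefficients on words of any other length vanish, as there is no bijection `π`). -/
noncomputable def odot {S X : Type} [Fintype S] [DecidableEq S] (ψ : S → X → ℂ) (l : Word X) : ℂ :=
  ((Real.sqrt (l.1.factorial : ℝ) : ℝ) : ℂ)⁻¹ * ∑ π : Fin l.1 ≃ S, ∏ i, ψ (π i) (l.2 i)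

/-- Coefficients of `symm (⨂_{s ∈ S} ψ_s)`, where each `ψ_s` is a single message that is in a
superposition of being on the wires `w ∈ W` (a vector of `⨁_w ℂ^{X w}`): expand the tensor product
into all distributions `d` of the messages to the wires, and symmetrise the messages on every wire. -/
noncomputable def symmFun {S W : Type} [Fintype S] [DecidableEq S] [Fintype W] [DecidableEq W]
    {X : W → Type} (ψ : S → (Σ w, X w) → ℂ) (l : ∀ w, Word (X w)) : ℂ :=
  ∑ d : S → W, ∏ w, odot (fun (s : {s : S // d s = w}) (x : X w) => ψ s.1 ⟨w, x⟩) (l w)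

theorem odot_perm {S X : Type} [Fintype S] [DecidableEq S] (ψ : S → X → ℂ) (l : Word X)
    (σ : Equiv.Perm (Fin l.1)) : odot ψ ⟨l.1, l.2 ∘ σ⟩ = odot ψ l := by
  unfold odot
  congr 1
  refine Fintype.sum_equiv (Equiv.equivCongr σ (Equiv.refl S)) _ _ ?_
  intro π
  refine Fintype.prod_equiv σ _ _ ?_
  intro i
  simp [Equiv.equivCongr]

theorem odot_ne_zero {S X : Type} [Fintype S] [DecidableEq S] {ψ : S → X → ℂ} {l : Word X}
    (h : odot ψ l ≠ 0) : l.1 = Fintype.card S := by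
  by_contra hne
  apply h
  have : IsEmpty (Fin l.1 ≃ S) := ⟨fun e => hne (by simpa using Fintype.card_congr e)⟩
  simp [odot]

theorem symmFun_finite {S W : Type} [Fintype S] [DecidableEq S] [Fintype W] [DecidableEq W]
    {X : W → Type} [∀ w, Finite (X w)] (ψ : S → (Σ w, X w) → ℂ) :
    (Function.support (symmFun ψ)).Finite := by
  have hfin : ∀ w, {v : Word (X w) | v.1 ≤ Fintype.card S}.Finite := by
    intro w
    refine (Set.finite_range
      (fun p : Σ n : Fin (Fintype.card S + 1), (Fin n → X w) => (⟨p.1, p.2⟩ : Word (X w)))).subset ?_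
    rintro ⟨n, v⟩ hn
    exact ⟨⟨⟨n, Nat.lt_succ_of_le hn⟩, v⟩, rfl⟩
  refine (Set.Finite.pi hfin).subset ?_
  intro l hl w _
  obtain ⟨d, -, hd⟩ := Finset.exists_ne_zero_of_sum_ne_zero hl
  have h := odot_ne_zero ((Finset.prod_ne_zero_iff.mp hd) w (Finset.mem_univ w))
  simp only [Set.mem_ofPred_eq]
  rw [h]
  exact Fintype.card_subtype_le _

/-- `symm (⨂_{s ∈ S} ψ_s)` as an element of the Fock space. For empty `S` it is the vacuum. -/
noncomputable def symm {S W : Type} [Fintype S] [DecidableEq S] [Fintype W] [DecidableEq W]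
    {X : W → Type} [∀ w, Finite (X w)] (ψ : S → (Σ w, X w) → ℂ) : Fock X :=
  ⟨⟨symmFun ψ, memℓp_gen (summable_of_hasFiniteSupport ((symmFun_finite ψ).subset (by
      intro l hl h0
      apply hl
      simp [h0])))⟩, by
    intro l σ
    change symmFun ψ _ = symmFun ψ l
    unfold symmFun
    refine Finset.sum_congr rfl fun d _ => Finset.prod_congr rfl fun w _ => ?_
    exact odot_perm _ (l w) (σ w)⟩

/-- The linear map on `ℂ^B` with prescribed values on the computational basis. -/
noncomputable def linExt {B E : Type} [Fintype B] [AddCommMonoid E] [Module ℂ E] (v : B → E) :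
    EuclideanSpace ℂ B →ₗ[ℂ] E where
  toFun x := ∑ b, x b • v b
  map_add' x y := by simp [add_smul, Finset.sum_add_distrib]
  map_smul' c x := by simp [mul_smul, Finset.smul_sum]

/-- The message-by-message extension of a single-message operator `T : ⨁_w ℂ^{X w} → ⨁_{w'} ℂ^{Y w'}`
to states with zero or one message on every wire `w`: a basis state carrying the messages `x_w` on the
non-vacuum wires is sent to `symm (⨂_w T|x_w⟩)`; in particular the vacuum is sent to the vacuum. -/
noncomputable def messagewise {W W' : Type} [Fintype W] [DecidableEq W] [Fintype W']
    [DecidableEq W'] {X : W → Type} {Y : W' → Type} [∀ w, Fintype (X w)] [∀ w, Finite (Y w)]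
    (T : Matrix (Σ w, Y w) (Σ w, X w) ℂ) :
    EuclideanSpace ℂ (∀ w, Option (X w)) →ₗ[ℂ] Fock Y :=
  linExt fun s => symm fun (w : {w : W // (s w).isSome = true}) y => T y ⟨w.1, (s w.1).get w.2⟩

/-! ### Quantum circuits with quantum control of causal order

The number of agents is `N = m + 1`; agents and time steps are both indexed by `Fin (m + 1)`
(the index `n` stands for the `(n+1)`-st time step).
-/

/-- Basis `|K, k⟩` (with `k` fixed) of the control system at step `n`: `K` is the set of the `n`
agents that acted before, and `k ∉ K` is the agent that acts at this step. -/
abbrev Ctrl {m : ℕ} (n k : Fin (m + 1)) : Type :=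
  {K : Finset (Fin (m + 1)) // K.card = (n : ℕ) ∧ k ∉ K}

/-- The ancilla and control systems that accompany a message. -/
abbrev Aux {m : ℕ} (α : Fin (m + 1) → Type) (n k : Fin (m + 1)) : Type := α n × Ctrl n k

/-- The internal operators of a QC-QC. `P`, `F`: global past and future (`F` includes a possible
purifying ancilla), `I k`, `O k`: input and output space of agent `k`, `α n`: ancilla at step `n`.
`first k` is `V^{→k}_{∅,∅}`, `mid n K k k'` is `V^{→k'}_{K,k}` (only used for `|K| = n`, `k ∉ K`,
`k' ∉ K ∪ {k}`), and `last k` is `V^{→F}_{𝒩∖k,k}`. -/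
structure InternalOps (m : ℕ) (P F : Type) (I O α : Fin (m + 1) → Type) where
  first : ∀ k, Matrix (I k × α 0) P ℂ
  mid : ∀ (n : Fin m) (_ : Finset (Fin (m + 1))) (k k' : Fin (m + 1)),
    Matrix (I k' × α n.succ) (O k × α n.castSucc) ℂ
  last : ∀ k, Matrix F (O k × α (Fin.last m)) ℂ

namespace InternalOps

variable {m : ℕ} {P F : Type} {I O α : Fin (m + 1) → Type} (Q : InternalOps m P F I O α)

/-- `V_1 = ∑_k V^{→k}_{∅,∅} ⊗ |∅, k⟩`. -/
def opFirst : Matrix (Σ k, I k × Aux α 0 k) P ℂ :=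
  fun y p => Q.first y.1 (y.2.1, y.2.2.1) p

/-- `V_{n+1} = ∑ V^{→k'}_{K,k} ⊗ |K ∪ k, k'⟩⟨K, k|`. -/
def opMid (n : Fin m) :
    Matrix (Σ k, I k × Aux α n.succ k) (Σ k, O k × Aux α n.castSucc k) ℂ :=
  fun y x => if y.2.2.2.1 = insert x.1 x.2.2.2.1 then
    Q.mid n x.2.2.2.1 x.1 y.1 (y.2.1, y.2.2.1) (x.2.1, x.2.2.1) else 0

/-- `V_{N+1} = ∑_k V^{→F}_{𝒩∖k,k} ⊗ ⟨𝒩∖k, k|`. -/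
def opLast : Matrix F (Σ k, O k × Aux α (Fin.last m) k) ℂ :=
  fun f x => Q.last x.1 f (x.2.1, x.2.2.1)

end InternalOps

/-- An `(m+1)`-partite QC-QC: the controlled internal operations `V_1, …, V_{N+1}` are isometries. -/
structure QCQC (m : ℕ) (P F : Type) (I O α : Fin (m + 1) → Type)
    [Fintype P] [DecidableEq P] [Fintype F]
    [∀ k, Fintype (I k)] [∀ k, Fintype (O k)] [∀ k, DecidableEq (O k)]
    [∀ n, Fintype (α n)] [∀ n, DecidableEq (α n)] extends InternalOps m P F I O α where
  first_isometry : toInternalOps.opFirst.conjTranspose * toInternalOps.opFirst = 1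
  mid_isometry : ∀ n, (toInternalOps.opMid n).conjTranspose * toInternalOps.opMid n = 1
  last_isometry : toInternalOps.opLast.conjTranspose * toInternalOps.opLast = 1

/-- The process vector `|w_{𝒩,F}⟩ = ∑_{(k_1,…,k_N)} |V^{→k_1}_{∅,∅}⟩⟩ * |V^{→k_2}_{∅,k_1}⟩⟩ * ⋯ *
|V^{→F}_{𝒩∖k_N,k_N}⟩⟩`: the sum runs over all orders `σ` of the agents and the link products contract
the ancillas `a`. -/
def InternalOps.processVector {m : ℕ} {P F : Type} {I O α : Fin (m + 1) → Type}
    [∀ n, Fintype (α n)] (Q : InternalOps m P F I O α) :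
    (∀ k, I k × O k) × (P × F) → ℂ :=
  fun z => ∑ σ : Equiv.Perm (Fin (m + 1)), ∑ a : (∀ n, α n),
    choiVec (Q.first (σ 0)) (z.2.1, ((z.1 (σ 0)).1, a 0))
    * (∏ n : Fin m,
        choiVec (Q.mid n ((Finset.Iio n.castSucc).image σ) (σ n.castSucc) (σ n.succ))
          (((z.1 (σ n.castSucc)).2, a n.castSucc), ((z.1 (σ n.succ)).1, a n.succ)))
    * choiVec (Q.last (σ (Fin.last m))) (((z.1 (σ (Fin.last m))).2, a (Fin.last m)), z.2.2)

/-! ### Process boxes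

The positions are `1, …, 2N+2`. The global past sends its message at position `1`, the global future
receives at position `2N+2`; at step `n` (counted from zero) the agents receive at position `2(n+1)`
and send at position `2(n+1)+1`. Besides the agent's own system, a message on the wires of agent `k`
at step `n` carries a system `R n k`, on which the agents act trivially.
-/

/-- Basis of the one-message space of the input wire of agent `k` at step `n`. -/
abbrev InMsg {m : ℕ} (I : Fin (m + 1) → Type) (R : Fin (m + 1) → Fin (m + 1) → Type)
    (n k : Fin (m + 1)) : Type := Msg (I k × R n k) (2 * ((n : ℕ) + 1))

/-- Basis of the one-message space of the output wire of agent `k` at step `n`. -/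
abbrev OutMsg {m : ℕ} (O : Fin (m + 1) → Type) (R : Fin (m + 1) → Fin (m + 1) → Type)
    (n k : Fin (m + 1)) : Type := Msg (O k × R n k) (2 * ((n : ℕ) + 1) + 1)

/-- Basis of the one-message space of the global past. -/
abbrev PastMsg (P : Type) : Type := Msg P 1

/-- Basis of the one-message space of the global future. -/
abbrev FutMsg (m : ℕ) (F : Type) : Type := Msg F (2 * (m + 1) + 2)

/-- A sequence representation `V̄_1, …, V̄_{N+1}` without internal memory: isometries from the
zero-or-one-message output wires of the agents at one position (one message of the global past, for
`V̄_1`) to the Fock space of the input wires at the next position (of the global future, for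
`V̄_{N+1}`). -/
structure SeqRep (m : ℕ) (P F : Type) (I O : Fin (m + 1) → Type)
    (R : Fin (m + 1) → Fin (m + 1) → Type)
    [Fintype P] [∀ k, Fintype (O k)] [∀ n k, Fintype (R n k)] where
  first : EuclideanSpace ℂ (PastMsg P) →ₗᵢ[ℂ] Fock (InMsg I R 0)
  mid : ∀ n : Fin m, EuclideanSpace ℂ (∀ k, Option (OutMsg O R n.castSucc k)) →ₗᵢ[ℂ]
    Fock (InMsg I R n.succ)
  last : EuclideanSpace ℂ (∀ k, Option (OutMsg O R (Fin.last m) k)) →ₗᵢ[ℂ]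
    Fock (fun _ : Unit => FutMsg m F)

namespace SeqRep

variable {m : ℕ} {P F : Type} {I O : Fin (m + 1) → Type} {R : Fin (m + 1) → Fin (m + 1) → Type}
  [Fintype P] [∀ k, Fintype (O k)] [∀ n k, Fintype (R n k)]

/-- What the box sends to the agents at step `n`, when the global past sent the basis message `p` and
the agents sent the basis states `o n` at the various steps `n`. -/
noncomputable def sends [DecidableEq P] [∀ k, DecidableEq (O k)] [∀ n k, DecidableEq (R n k)]
    (B : SeqRep m P F I O R) (p : PastMsg P)
    (o : ∀ n k, Option (OutMsg O R n k)) (n : Fin (m + 1)) : Fock (InMsg I R n) :=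
  Fin.cases (motive := fun n => Fock (InMsg I R n)) (B.first (EuclideanSpace.single p 1))
    (fun j => B.mid j (EuclideanSpace.single (o j.castSucc) 1)) n

/-- The Choi vector `|V̄⟩⟩` of the box: its component on the message `p` of the global past, the output
wires `o`, the input wires `l`, and the wire `f` of the global future. -/
noncomputable def choi [DecidableEq P] [∀ k, DecidableEq (O k)] [∀ n k, DecidableEq (R n k)]
    (B : SeqRep m P F I O R) (p : PastMsg P)
    (o : ∀ n k, Option (OutMsg O R n k)) (l : ∀ n k, Word (InMsg I R n k))
    (f : Word (FutMsg m F)) : ℂ :=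
  (∏ n, (B.sends p o n).1 (l n))
    * (B.last (EuclideanSpace.single (o (Fin.last m)) 1)).1 (fun _ => f)

/-- The basis states of one agent's wires that span the effective space: at most one position `t` at
which a message is received, a message is sent at most at the corresponding output position, and
a vacuum input forces a vacuum output. -/
def Eff {k : Fin (m + 1)} (i : ∀ n, Option (InMsg I R n k))
    (o : ∀ n, Option (OutMsg O R n k)) : Prop :=
  ∃ t, (∀ n, n ≠ t → i n = none ∧ o n = none) ∧ (i t = none → o t = none)

open Classical in
/-- The effective Choi vector: the projection of the Choi vector to the effective space (with exactly
one message for the global past and the global future). -/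
noncomputable def effChoi [DecidableEq P] [∀ k, DecidableEq (O k)] [∀ n k, DecidableEq (R n k)]
    (B : SeqRep m P F I O R) :
    (∀ k, (∀ n, Option (InMsg I R n k)) × (∀ n, Option (OutMsg O R n k)))
      × (PastMsg P × FutMsg m F) → ℂ :=
  fun z => if ∀ k, Eff (z.1 k).1 (z.1 k).2 then
    B.choi z.2.1 (fun n k => (z.1 k).2 n) (fun n k => wordOf ((z.1 k).1 n)) (wordOf (some z.2.2))
  else 0

/-- The basis states between which local operations have non-zero matrix elements at one step: the
vacuum is sent if and only if the vacuum was received, and the system `R` of a message is unchanged. -/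
def Compatible {n k : Fin (m + 1)} (l : Word (InMsg I R n k)) (o : Option (OutMsg O R n k)) : Prop :=
  (l.1 = 0 ↔ o = none) ∧ ∀ x y, l = wordOf (some x) → o = some y → y.1.2 = x.1.2

/-- The requirement that makes the box a process box: if it is composed with local operations that map
the vacuum to the vacuum and a message to a message one position later, then in every history of
non-zero amplitude each agent receives exactly one message during the entire run. -/
def IsProcessBox [DecidableEq P] [∀ k, DecidableEq (O k)] [∀ n k, DecidableEq (R n k)]
    (B : SeqRep m P F I O R) : Prop :=
  ∀ (p : PastMsg P) (l : ∀ n k, Word (InMsg I R n k)) (o : ∀ n k, Option (OutMsg O R n k)),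
    (∀ n k, Compatible (l n k) (o n k)) → (∀ n, (B.sends p o n).1 (l n) ≠ 0) →
    ∀ k, ∑ n, (l n k).1 = 1

end SeqRep

/-! ### Operational equivalence -/

/-- Matrix elements of `A ⊗ 1^R ⊗ |t+1⟩⟨t| + |Ω, t+1⟩⟨Ω, t|`. -/
def localSlot {m : ℕ} {I O : Fin (m + 1) → Type} {R : Fin (m + 1) → Fin (m + 1) → Type}
    [∀ n k, DecidableEq (R n k)] {k : Fin (m + 1)} (A : Matrix (O k) (I k) ℂ) (n : Fin (m + 1)) :
    Matrix (Option (OutMsg O R n k)) (Option (InMsg I R n k)) ℂ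
  | none, none => 1
  | some y, some x => if y.1.2 = x.1.2 then A y.1.1 x.1.1 else 0
  | none, some _ => 0
  | some _, none => 0

/-- The local operation `A` of a QC-QC agent and the local operation `Abar` of the process box agent
are operationally equivalent: `Ā = ⨂_t (A ⊗ |t+1⟩⟨t| + |Ω, t+1⟩⟨Ω, t|)`. -/
def LocalEquiv {m : ℕ} {I O : Fin (m + 1) → Type} {R : Fin (m + 1) → Fin (m + 1) → Type}
    [∀ n k, DecidableEq (R n k)] {k : Fin (m + 1)} (A : Matrix (O k) (I k) ℂ)
    (Abar : Matrix (∀ n, Option (OutMsg O R n k)) (∀ n, Option (InMsg I R n k)) ℂ) : Prop :=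
  ∀ o i, Abar o i = ∏ n, localSlot A n (o n) (i n)

/-- A QC-QC and a process box are operationally equivalent: for all operationally equivalent local
operations `(|A_1⟩⟩ ⊗ ⋯ ⊗ |A_N⟩⟩) * |w⟩ ≅ (|Ā_1⟩⟩ ⊗ ⋯ ⊗ |Ā_N⟩⟩) * |V̄⟩⟩`, with `|V̄⟩⟩` the effective
Choi vector, up to fixed unitary isomorphisms of the global pasts and of the global futures. -/
def OperationallyEquivalent {m : ℕ} {P F : Type} {I O α : Fin (m + 1) → Type}
    {R : Fin (m + 1) → Fin (m + 1) → Type}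
    [Fintype P] [DecidableEq P] [Fintype F] [DecidableEq F]
    [∀ k, Fintype (I k)] [∀ k, Fintype (O k)] [∀ k, DecidableEq (O k)]
    [∀ n, Fintype (α n)] [∀ n k, Fintype (R n k)] [∀ n k, DecidableEq (R n k)]
    (Q : InternalOps m P F I O α) (B : SeqRep m P F I O R) : Prop :=
  ∃ (UP : Matrix (PastMsg P) P ℂ) (UF : Matrix (FutMsg m F) F ℂ),
    IsUnitary UP ∧ IsUnitary UF ∧
    ∀ (A : ∀ k, Matrix (O k) (I k) ℂ)
      (Abar : ∀ k, Matrix (∀ n, Option (OutMsg O R n k)) (∀ n, Option (InMsg I R n k)) ℂ),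
      (∀ k, LocalEquiv (A k) (Abar k)) →
      (UP ⊗ₖ UF).mulVec (link (tensorChoi A) Q.processVector)
        = link (tensorChoi Abar) B.effChoi

/-! ### The process box of a QC-QC -/

namespace InternalOps

variable {m : ℕ} {P F : Type} {I O α : Fin (m + 1) → Type}
  [Fintype P] [Fintype F] [∀ k, Fintype (I k)] [∀ k, Fintype (O k)] [∀ n, Fintype (α n)]
  (Q : InternalOps m P F I O α)

/-- `V̄_1 |ψ, t=1⟩ = ∑_k V^{→k}_{∅,∅}|ψ⟩ |t=2⟩ |∅, k⟩`. -/
noncomputable def barFirst :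
    EuclideanSpace ℂ (PastMsg P) →ₗ[ℂ] Fock (InMsg I (Aux α) 0) :=
  linExt fun p => symm fun (_ : Unit) y => Q.opFirst ⟨y.1, y.2.1⟩ p.1

/-- `V̄_{n+1}`: apply `V_{n+1}` to every message `|ψ^k, t=2n+1⟩|K^k, k⟩`, put the time stamp `2n+2`,
and symmetrise. -/
noncomputable def barMid (n : Fin m) :
    EuclideanSpace ℂ (∀ k, Option (OutMsg O (Aux α) n.castSucc k)) →ₗ[ℂ]
      Fock (InMsg I (Aux α) n.succ) :=
  messagewise (fun y x => Q.opMid n ⟨y.1, y.2.1⟩ ⟨x.1, x.2.1⟩)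

/-- `V̄_{N+1}`: apply `V_{N+1}` to every message, put the time stamp `2N+2`, and symmetrise on the wire
of the global future. -/
noncomputable def barLast :
    EuclideanSpace ℂ (∀ k, Option (OutMsg O (Aux α) (Fin.last m) k)) →ₗ[ℂ]
      Fock (fun _ : Unit => FutMsg m F) :=
  messagewise (fun y x => Q.opLast y.2.1 ⟨x.1, x.2.1⟩)

end InternalOps

end QCPB

namespace QCPB

open scoped ComplexConjugate

/-! Isometry: with the factor `1/√(n!)`, the inner product of two symmetrised products of messages
is the permanent of the matrix of inner products of their factors (`symm_inner`). For the images of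
two basis states with at most one message per wire, these entries are Kronecker deltas, because the
single-message operator is an isometry. Messages on distinct wires are orthogonal, so at most one
bijection survives and the permanent is 1 or 0 (`orthonormal_messagewise`). Basis states therefore
go to orthonormal families, even when several messages meet on one receiving wire.

Process box: the past sends one message, and both the box and the admissible local operations
conserve the number of messages, so exactly one message travels at each step. A non-zero amplitude
forces its control set to grow by the agent just visited, while the acting agent lies outside that
set. Hence no agent is visited twice; with as many steps as agents, the visiting order is a
permutation (`QCQC.exists_history`).

Equivalence: the histories that can contribute are parametrised injectively by local basis states,
an agent order and ancilla basis states (`historyOf`). Each has as amplitude the corresponding term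
of the process vector (`QCQC.effChoi_historyOf`), so the two link products agree term by term. -/

/-! ### Inner products of symmetrised product states as permanents. -/

/-- The one-wire permanent formula. If `S` and `S'` have different sizes, there is no bijection and
both sides vanish. The set `t` only has to contain the words on which `odot ψ` can be non-zero. -/
theorem odot_inner {S S' X : Type} [Fintype S] [DecidableEq S] [Fintype S'] [DecidableEq S']
    [Fintype X] (ψ : S → X → ℂ) (χ : S' → X → ℂ) (t : Finset (Word X))
    (ht : ∀ l : Word X, l.1 = Fintype.card S → l ∈ t) :
    ∑ l ∈ t, conj (odot ψ l) * odot χ l = ∑ e : S ≃ S', ∏ s, ∑ x, conj (ψ s x) * χ (e s) x := by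
  classical
  set n := Fintype.card S with hn
  have h1 : ∑ l ∈ t, conj (odot ψ l) * odot χ l
      = ∑ v : Fin n → X, conj (odot ψ ⟨n, v⟩) * odot χ ⟨n, v⟩ := by
    symm
    refine Finset.sum_of_injOn (fun v => (⟨n, v⟩ : Word X)) ?_ ?_ ?_ ?_
    · intro v _ v' _ h
      simpa using h
    · intro v _
      exact ht _ rfl
    · rintro ⟨k, v⟩ _ h
      by_contra h0
      have hk : k = n := odot_ne_zero (ψ := ψ) (l := ⟨k, v⟩) (by
        intro h2
        simp [h2] at h0)
      subst hk
      exact h ⟨v, by simp, rfl⟩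
    · intro v _
      rfl
  have hf : ((Real.sqrt (n.factorial : ℝ) : ℝ) : ℂ)⁻¹ * ((Real.sqrt (n.factorial : ℝ) : ℝ) : ℂ)⁻¹
      = (n.factorial : ℂ)⁻¹ := by
    rw [← mul_inv, ← Complex.ofReal_mul, Real.mul_self_sqrt (by positivity)]
    simp
  have h2 : ∀ v : Fin n → X, conj (odot ψ ⟨n, v⟩) * odot χ ⟨n, v⟩
      = (n.factorial : ℂ)⁻¹ * ∑ π : Fin n ≃ S, ∑ π' : Fin n ≃ S',
        ∏ i, conj (ψ (π i) (v i)) * χ (π' i) (v i) := by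
    intro v
    rw [← hf]
    simp only [odot, map_mul, map_inv₀, Complex.conj_ofReal, map_sum, map_prod,
      Finset.prod_mul_distrib, ← Finset.sum_mul_sum]
    ring
  -- Summing over the letters one position at a time gives a product of inner products, which
  -- depends on the two bijections only through the induced matching of `S` with `S'`.
  have h3 : ∀ (π : Fin n ≃ S) (π' : Fin n ≃ S'),
      ∑ v : Fin n → X, ∏ i, conj (ψ (π i) (v i)) * χ (π' i) (v i)
        = ∏ s, ∑ x, conj (ψ s x) * χ ((π.symm.trans π') s) x := by
    intro π π'
    rw [← Fintype.prod_sum (fun i x => conj (ψ (π i) x) * χ (π' i) x)]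
    exact Fintype.prod_equiv π _ _ (by simp)
  have h4 : ∀ π : Fin n ≃ S,
      ∑ π' : Fin n ≃ S', ∏ s, ∑ x, conj (ψ s x) * χ ((π.symm.trans π') s) x
        = ∑ e : S ≃ S', ∏ s, ∑ x, conj (ψ s x) * χ (e s) x := by
    intro π
    exact Fintype.sum_equiv (Equiv.equivCongr π (Equiv.refl S')) _ _ (fun π' => rfl)
  rw [h1]
  simp only [h2]
  rw [← Finset.mul_sum, Finset.sum_comm]
  have h5 : ∀ π : Fin n ≃ S, ∑ v : Fin n → X, ∑ π' : Fin n ≃ S',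
        ∏ i, conj (ψ (π i) (v i)) * χ (π' i) (v i)
      = ∑ e : S ≃ S', ∏ s, ∑ x, conj (ψ s x) * χ (e s) x := by
    intro π
    rw [Finset.sum_comm]
    simp only [h3, h4]
  simp only [h5]
  -- All `n!` choices of `π` contribute equally, which cancels the normalisation `1/n!`.
  rw [Finset.sum_const, Finset.card_univ, Fintype.card_equiv (Fintype.equivFinOfCardEq hn.symm).symm,
    Fintype.card_fin, nsmul_eq_mul, inv_mul_cancel_left₀]
  exact_mod_cast n.factorial_ne_zero

/-- For fixed distributions `d`, `d'` the inner product factors over wires into permanents, that is,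
into a sum over families of bijections between the fibres. Summing over both distributions turns
these into all bijections `S ≃ S'` and full inner products over all wires. -/
theorem symmFun_inner {S S' W : Type} [Fintype S] [DecidableEq S] [Fintype S'] [DecidableEq S']
    [Fintype W] [DecidableEq W] {X : W → Type} [∀ w, Fintype (X w)]
    (ψ : S → (Σ w, X w) → ℂ) (χ : S' → (Σ w, X w) → ℂ) (t : ∀ w, Finset (Word (X w)))
    (ht : ∀ w (l : Word (X w)), l.1 ≤ Fintype.card S → l ∈ t w) :
    ∑ l ∈ Fintype.piFinset t, conj (symmFun ψ l) * symmFun χ l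
      = ∑ e : S ≃ S', ∏ s, ∑ x, conj (ψ s x) * χ (e s) x := by
  have h1 : ∀ (d : S → W) (d' : S' → W),
      ∑ l ∈ Fintype.piFinset t,
        ∏ w, (conj (odot (fun (s : {s : S // d s = w}) (x : X w) => ψ s.1 ⟨w, x⟩) (l w))
          * odot (fun (s : {s : S' // d' s = w}) (x : X w) => χ s.1 ⟨w, x⟩) (l w))
      = ∑ e : (∀ w, {s : S // d s = w} ≃ {s : S' // d' s = w}), ∏ w, ∏ s : {s : S // d s = w},
          ∑ x : X w, conj (ψ s.1 ⟨w, x⟩) * χ (e w s).1 ⟨w, x⟩ := by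
    intro d d'
    rw [← Finset.prod_univ_sum t (fun w l =>
      conj (odot (fun (s : {s : S // d s = w}) (x : X w) => ψ s.1 ⟨w, x⟩) l)
          * odot (fun (s : {s : S' // d' s = w}) (x : X w) => χ s.1 ⟨w, x⟩) l)]
    refine Eq.trans ?_ (Fintype.prod_sum
      (fun w (e : {s : S // d s = w} ≃ {s : S' // d' s = w}) => ∏ s : {s : S // d s = w},
          ∑ x : X w, conj (ψ s.1 ⟨w, x⟩) * χ (e s).1 ⟨w, x⟩))
    refine Finset.prod_congr rfl fun w _ => ?_
    exact odot_inner _ _ (t w) fun l hl => ht w l (hl.le.trans (Fintype.card_subtype_le _))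
  -- With `d` fixed, a distribution `d'` together with fibrewise bijections is the same as one
  -- bijection `e : S ≃ S'`: glue the fibres in one direction, take `d' = d ∘ e.symm` in the other.
  have h2 : ∀ d : S → W, ∑ d' : S' → W,
      ∑ e : (∀ w, {s : S // d s = w} ≃ {s : S' // d' s = w}), ∏ w, ∏ s : {s : S // d s = w},
          ∑ x : X w, conj (ψ s.1 ⟨w, x⟩) * χ (e w s).1 ⟨w, x⟩
      = ∑ e : S ≃ S', ∏ s, ∑ x : X (d s), conj (ψ s ⟨d s, x⟩) * χ (e s) ⟨d s, x⟩ := by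
    intro d
    rw [← Fintype.sum_sigma']
    refine Fintype.sum_bijective (fun p : (Σ d' : S' → W,
      ∀ w, {s : S // d s = w} ≃ {s : S' // d' s = w}) => Equiv.ofFiberEquiv p.2) ⟨?_, ?_⟩ _ _ ?_
    · rintro ⟨d', e⟩ ⟨d'', e'⟩ h
      have hd : d' = d'' := by
        funext s'
        obtain ⟨s, rfl⟩ := (Equiv.ofFiberEquiv e).surjective s'
        have := Equiv.ofFiberEquiv_map e s
        have h' := Equiv.ofFiberEquiv_map e' s
        simp only at h
        rw [this, h, h']
      subst hd
      congr 1
      funext w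
      ext ⟨s, rfl⟩
      exact congrArg (fun f => f s) h
    · intro e
      refine ⟨⟨d ∘ e.symm, fun w => e.subtypeEquiv (by simp)⟩, ?_⟩
      ext s
      simp [Equiv.ofFiberEquiv]
    · rintro ⟨d', e⟩
      rw [← Fintype.prod_sigma', ← (Equiv.sigmaFiberEquiv d).prod_comp]
      refine Finset.prod_congr rfl ?_
      rintro ⟨w, s, rfl⟩ _
      rfl
  calc ∑ l ∈ Fintype.piFinset t, conj (symmFun ψ l) * symmFun χ l
      = ∑ l ∈ Fintype.piFinset t, ∑ d : S → W, ∑ d' : S' → W,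
        ∏ w, (conj (odot (fun (s : {s : S // d s = w}) (x : X w) => ψ s.1 ⟨w, x⟩) (l w))
          * odot (fun (s : {s : S' // d' s = w}) (x : X w) => χ s.1 ⟨w, x⟩) (l w)) := by
        refine Finset.sum_congr rfl fun l _ => ?_
        simp only [symmFun, map_sum, map_prod, Finset.sum_mul_sum, Finset.prod_mul_distrib]
    _ = ∑ d : S → W, ∑ e : S ≃ S',
        ∏ s, ∑ x : X (d s), conj (ψ s ⟨d s, x⟩) * χ (e s) ⟨d s, x⟩ := by
        rw [Finset.sum_comm]
        refine Finset.sum_congr rfl fun d _ => ?_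
        rw [Finset.sum_comm, ← h2]
        exact Finset.sum_congr rfl fun d' _ => h1 d d'
    _ = _ := by
        rw [Finset.sum_comm]
        refine Finset.sum_congr rfl fun e _ => ?_
        rw [← Fintype.prod_sum (fun s w => ∑ x : X w, conj (ψ s ⟨w, x⟩) * χ (e s) ⟨w, x⟩)]
        refine Finset.prod_congr rfl fun s _ => ?_
        rw [Fintype.sum_sigma]

theorem symm_inner {S S' W : Type} [Fintype S] [DecidableEq S] [Fintype S'] [DecidableEq S']
    [Fintype W] [DecidableEq W] {X : W → Type} [∀ w, Fintype (X w)]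
    (ψ : S → (Σ w, X w) → ℂ) (χ : S' → (Σ w, X w) → ℂ) :
    inner ℂ (symm ψ) (symm χ) = ∑ e : S ≃ S', ∏ s, ∑ x, conj (ψ s x) * χ (e s) x := by
  classical
  -- Words of length at most `|S|` support `symmFun ψ`, so the ℓ² series is a finite sum.
  let t : ∀ w, Finset (Word (X w)) := fun w =>
    Finset.univ.image
      (fun p : Σ n : Fin (Fintype.card S + 1), (Fin n → X w) => (⟨p.1, p.2⟩ : Word (X w)))
  have ht : ∀ w (l : Word (X w)), l.1 ≤ Fintype.card S → l ∈ t w := by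
    rintro w ⟨n, v⟩ hn
    exact Finset.mem_image.mpr ⟨⟨⟨n, Nat.lt_succ_of_le hn⟩, v⟩, Finset.mem_univ _, rfl⟩
  rw [← symmFun_inner ψ χ t ht, Submodule.coe_inner, lp.inner_eq_tsum, tsum_eq_sum]
  · refine Finset.sum_congr rfl fun l _ => ?_
    rw [mul_comm]
    rfl
  · intro l hl
    have h0 : symmFun ψ l = 0 := by
      by_contra h0
      obtain ⟨d, -, hd⟩ := Finset.exists_ne_zero_of_sum_ne_zero h0
      refine hl (Fintype.mem_piFinset.mpr fun w => ht w _ ?_)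
      rw [odot_ne_zero ((Finset.prod_ne_zero_iff.mp hd) w (Finset.mem_univ w))]
      exact Fintype.card_subtype_le _
    change inner ℂ (symmFun ψ l) (symmFun χ l) = 0
    simp [h0]

/-! ### The extended maps are isometries -/

theorem linExt_single {B E : Type} [Fintype B] [DecidableEq B] [AddCommMonoid E] [Module ℂ E]
    (v : B → E) (b : B) : linExt v (EuclideanSpace.single b 1) = v b := by
  change ∑ c, (EuclideanSpace.single b (1 : ℂ) : EuclideanSpace ℂ B) c • v c = v b
  rw [Finset.sum_eq_single b]
  · simp
  · intro c _ hc
    simp [hc]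
  · simp

theorem norm_linExt {B E : Type} [Fintype B] [NormedAddCommGroup E] [InnerProductSpace ℂ E]
    {v : B → E} (hv : Orthonormal ℂ v) (x : EuclideanSpace ℂ B) : ‖linExt v x‖ = ‖x‖ := by
  have h : inner ℂ (linExt v x) (linExt v x) = inner ℂ x x := by
    change inner ℂ (∑ b, x b • v b) (∑ b, x b • v b) = inner ℂ x x
    rw [hv.inner_sum, PiLp.inner_apply]
    exact Finset.sum_congr rfl fun b _ => mul_comm _ _
  rw [inner_self_eq_norm_sq_to_K, inner_self_eq_norm_sq_to_K] at h
  have h' : ‖linExt v x‖ ^ 2 = ‖x‖ ^ 2 := by exact_mod_cast h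
  exact (sq_eq_sq₀ (norm_nonneg _) (norm_nonneg _)).mp h'

/-- A bijection contributes to the permanent only if it matches every message with an equal one on
the same wire. This forces `s = s'` and the identity bijection, so the permanent has a single term 1
or none. -/
theorem orthonormal_messagewise {W W' : Type} [Fintype W] [DecidableEq W] [Fintype W']
    [DecidableEq W'] {X : W → Type} {Y : W' → Type} [∀ w, Fintype (X w)]
    [∀ w, DecidableEq (X w)] [∀ w, Fintype (Y w)] {T : Matrix (Σ w, Y w) (Σ w, X w) ℂ}
    (hT : ∀ a b, ∑ y, conj (T y a) * T y b = if a = b then 1 else 0) :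
    Orthonormal ℂ (fun s : ∀ w, Option (X w) =>
      symm fun (w : {w : W // (s w).isSome = true}) y => T y ⟨w.1, (s w.1).get w.2⟩) := by
  classical
  rw [orthonormal_iff_ite]
  intro s s'
  rw [symm_inner]
  simp only [hT, Fintype.prod_ite_zero, Finset.prod_const_one]
  have key : ∀ e : {w : W // (s w).isSome = true} ≃ {w : W // (s' w).isSome = true},
      (∀ w, (⟨w.1, (s w.1).get w.2⟩ : Σ w, X w) = ⟨(e w).1, (s' (e w).1).get (e w).2⟩) →
      s = s' ∧ ∀ w, (e w).1 = w.1 := by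
    intro e he
    have h1 : ∀ w, (e w).1 = w.1 := fun w => (congrArg Sigma.fst (he w)).symm
    refine ⟨?_, h1⟩
    have h2 : ∀ (w : W) (h : (s w).isSome = true), s w = s' w := by
      intro w h
      have h3 := he ⟨w, h⟩
      generalize he' : e ⟨w, h⟩ = q at h3
      have h4 : q.1 = w := by rw [← he', h1]
      obtain ⟨q, hq⟩ := q
      simp only at h4
      subst h4
      simp only [Sigma.mk.injEq, heq_eq_eq, true_and] at h3
      rw [← Option.some_get h, ← Option.some_get hq, h3]
    funext w
    by_cases h : (s w).isSome = true
    · exact h2 w h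
    · by_cases h' : (s' w).isSome = true
      -- A message of `s'` on `w` is matched with a message of `s`, which sits on the same wire; so
      -- `w` cannot be vacant in `s`.
      · obtain ⟨⟨q, hq⟩, hqe⟩ := e.surjective ⟨w, h'⟩
        have h5 := h1 ⟨q, hq⟩
        rw [hqe] at h5
        simp only at h5
        subst h5
        exact h2 _ hq
      · simp only [Option.isSome_iff_ne_none, ne_eq, not_not] at h h'
        rw [h, h']
  by_cases hs : s = s'
  · subst hs
    rw [if_pos rfl, Finset.sum_eq_single (Equiv.refl _)]
    · simp
    · intro e _ hne
      rw [if_neg]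
      intro he
      exact hne (Equiv.ext fun w => Subtype.ext ((key e he).2 w))
    · simp
  · rw [if_neg hs]
    refine Finset.sum_eq_zero fun e _ => ?_
    rw [if_neg]
    intro he
    exact hs (key e he).1

theorem orthonormal_symm_unit {B W : Type} [DecidableEq B] [Fintype W] [DecidableEq W]
    {X : W → Type} [∀ w, Fintype (X w)] {T : Matrix (Σ w, X w) B ℂ}
    (hT : ∀ a b, ∑ y, conj (T y a) * T y b = if a = b then 1 else 0) :
    Orthonormal ℂ (fun b : B => symm fun (_ : Unit) y => T y b) := by
  rw [orthonormal_iff_ite]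
  intro b b'
  rw [symm_inner]
  simp [hT]

/-- Transfers `T†T = 1` to the time-stamped bases: the stamp ranges over a one-element type, so
dropping it is a bijective relabelling. -/
theorem sum_conj_mul_of_isometry {X X' Y Y' : Type} [Fintype Y] [Fintype Y'] [DecidableEq X]
    [DecidableEq X'] {T : Matrix Y X ℂ} (hT : T.conjTranspose * T = 1) (f : X' → X) (g : Y' → Y)
    (hf : f.Injective) (hg : g.Bijective) (a b : X') :
    ∑ y, conj (T (g y) (f a)) * T (g y) (f b) = if a = b then 1 else 0 := by
  rw [hg.sum_comp (fun y => conj (T y (f a)) * T y (f b))]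
  have h := congrFun (congrFun hT (f a)) (f b)
  rw [Matrix.one_apply] at h
  simpa [Matrix.mul_apply, hf.eq_iff] using h

section Box

variable {m : ℕ} {P F : Type} {I O α : Fin (m + 1) → Type}
  [Fintype P] [DecidableEq P] [Fintype F]
  [∀ k, Fintype (I k)] [∀ k, Fintype (O k)] [∀ k, DecidableEq (O k)]
  [∀ n, Fintype (α n)] [∀ n, DecidableEq (α n)]

theorem bijective_sigma_dropTime {W : Type} (X : W → Type) (t : ℕ) :
    Function.Bijective (fun y : Σ w, Msg (X w) t => (⟨y.1, y.2.1⟩ : Σ w, X w)) := by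
  constructor
  · rintro ⟨w, x, s, rfl⟩ ⟨w', x', s', hs⟩ h
    subst hs
    cases h
    rfl
  · rintro ⟨w, x⟩
    exact ⟨⟨w, x, t, rfl⟩, rfl⟩

theorem QCQC.norm_barFirst (Q : QCQC m P F I O α) (x : EuclideanSpace ℂ (PastMsg P)) :
    ‖Q.barFirst x‖ = ‖x‖ := by
  refine norm_linExt (orthonormal_symm_unit
    (T := fun (y : Σ k, InMsg I (Aux α) 0 k) (p : PastMsg P) => Q.opFirst ⟨y.1, y.2.1⟩ p.1) ?_) x
  refine sum_conj_mul_of_isometry Q.first_isometry Prod.fst _ ?_ (bijective_sigma_dropTime _ _)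
  rintro ⟨x, s, rfl⟩ ⟨y, s', hs⟩ h
  subst hs
  cases h
  rfl

theorem QCQC.norm_barMid (Q : QCQC m P F I O α) (n : Fin m)
    (x : EuclideanSpace ℂ (∀ k, Option (OutMsg O (Aux α) n.castSucc k))) :
    ‖Q.barMid n x‖ = ‖x‖ := by
  refine norm_linExt (orthonormal_messagewise
    (T := fun (y : Σ k, InMsg I (Aux α) n.succ k) (x : Σ k, OutMsg O (Aux α) n.castSucc k) =>
      Q.opMid n ⟨y.1, y.2.1⟩ ⟨x.1, x.2.1⟩) ?_) x
  exact sum_conj_mul_of_isometry (Q.mid_isometry n) _ _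
    (bijective_sigma_dropTime _ _).1 (bijective_sigma_dropTime _ _)

theorem QCQC.norm_barLast (Q : QCQC m P F I O α)
    (x : EuclideanSpace ℂ (∀ k, Option (OutMsg O (Aux α) (Fin.last m) k))) :
    ‖Q.barLast x‖ = ‖x‖ := by
  refine norm_linExt (orthonormal_messagewise
    (T := fun (y : Σ _ : Unit, FutMsg m F) (x : Σ k, OutMsg O (Aux α) (Fin.last m) k) =>
      Q.opLast y.2.1 ⟨x.1, x.2.1⟩) ?_) x
  have hg : Function.Bijective (fun y : Σ _ : Unit, FutMsg m F => y.2.1) := by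
    refine ⟨?_, fun x => ⟨⟨(), x, _, rfl⟩, rfl⟩⟩
    rintro ⟨_, x, s, rfl⟩ ⟨_, x', s', hs⟩ h
    subst hs
    cases h
    rfl
  exact sum_conj_mul_of_isometry Q.last_isometry _ _ (bijective_sigma_dropTime _ _).1 hg

/-- The process box of a QC-QC. -/
noncomputable def QCQC.box (Q : QCQC m P F I O α) : SeqRep m P F I O (Aux α) where
  first := ⟨Q.barFirst, Q.norm_barFirst⟩
  mid n := ⟨Q.barMid n, Q.norm_barMid n⟩
  last := ⟨Q.barLast, Q.norm_barLast⟩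

end Box

/-! ### States with a single message -/

/-- The basis state with the message `x` on the wire `w`, and the vacuum on all other wires. -/
def oneMsg {W : Type} [DecidableEq W] {X : W → Type} (w : W) (x : X w) : ∀ w, Option (X w) :=
  Function.update (fun _ => none) w (some x)

theorem oneMsg_self {W : Type} [DecidableEq W] {X : W → Type} (w : W) (x : X w) :
    oneMsg w x w = some x := Function.update_self ..

theorem oneMsg_of_ne {W : Type} [DecidableEq W] {X : W → Type} {w w' : W} (x : X w) (h : w' ≠ w) :
    oneMsg w x w' = none := Function.update_of_ne h ..

theorem exists_wordOf_some {X : Type} {l : Word X} (h : l.1 = 1) : ∃ x, l = wordOf (some x) := by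
  obtain ⟨n, v⟩ := l
  simp only at h
  subst h
  refine ⟨v 0, ?_⟩
  simp only [wordOf, Sigma.mk.injEq, heq_eq_eq, true_and]
  funext i
  rw [Subsingleton.elim i 0]

theorem eq_wordOf_none {X : Type} {l : Word X} (h : l.1 = 0) : l = wordOf none := by
  obtain ⟨n, v⟩ := l
  simp only at h
  subst h
  simp only [wordOf, Sigma.mk.injEq, heq_eq_eq, true_and]
  exact Subsingleton.elim _ _

theorem wordOf_injective {X : Type} : Function.Injective (wordOf (X := X)) := by
  rintro (_ | x) (_ | y) h
  · rfl
  · simp [wordOf] at h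
  · simp [wordOf] at h
  · simp only [wordOf, Sigma.mk.injEq, heq_eq_eq, true_and] at h
    rw [congrFun h 0]

theorem odot_wordOf_none {S X : Type} [Fintype S] [DecidableEq S] [IsEmpty S] (ψ : S → X → ℂ) :
    odot ψ (wordOf none) = 1 := by
  have : Unique (Fin 0 ≃ S) := ⟨⟨Equiv.equivOfIsEmpty _ _⟩, fun _ => Subsingleton.elim _ _⟩
  unfold odot wordOf
  rw [Fintype.sum_unique]
  simp

theorem odot_wordOf_some {S X : Type} [Fintype S] [DecidableEq S] [Unique S] (ψ : S → X → ℂ)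
    (x : X) : odot ψ (wordOf (some x)) = ψ default x := by
  have : Unique (Fin 1 ≃ S) := ⟨⟨Equiv.ofUnique _ _⟩, fun _ => Subsingleton.elim _ _⟩
  unfold odot wordOf
  rw [Fintype.sum_unique, Fin.prod_univ_one, Unique.eq_default ((default : Fin 1 ≃ S) 0)]
  simp

theorem symm_apply {S W : Type} [Fintype S] [DecidableEq S] [Fintype W] [DecidableEq W]
    {X : W → Type} [∀ w, Finite (X w)] (ψ : S → (Σ w, X w) → ℂ) (l : ∀ w, Word (X w)) :
    (symm ψ).1 l = symmFun ψ l := rfl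

section OneMessage

variable {S W : Type} [Fintype S] [DecidableEq S] [Unique S] [Fintype W] [DecidableEq W]
    {X : W → Type}

theorem symmFun_oneMsg (ψ : S → (Σ w, X w) → ℂ) (w : W) (x : X w) :
    symmFun ψ (fun w' => wordOf (oneMsg w x w')) = ψ default ⟨w, x⟩ := by
  unfold symmFun
  rw [Finset.sum_eq_single (fun _ => w), Finset.prod_eq_single w]
  · let : Unique {s : S // w = w} := ⟨⟨⟨default, rfl⟩⟩, fun s => Subtype.ext (Unique.eq_default _)⟩
    beta_reduce
    rw [oneMsg_self, odot_wordOf_some]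
    rfl
  · intro w' _ hw
    have : IsEmpty {s : S // w = w'} := ⟨fun s => hw s.2.symm⟩
    beta_reduce
    rw [oneMsg_of_ne x hw, odot_wordOf_none]
  · simp
  -- Word lengths must equal the fibre sizes of `d`, so the wire `w` must have received the only
  -- message.
  · intro d _ hd
    rw [Finset.prod_eq_zero (Finset.mem_univ w)]
    by_contra h
    have h1 := odot_ne_zero h
    beta_reduce at h1
    rw [oneMsg_self] at h1
    change 1 = _ at h1
    obtain ⟨⟨s, hs⟩⟩ := Fintype.card_pos_iff.mp (h1 ▸ Nat.one_pos)
    refine hd (funext fun s' => ?_)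
    rw [← hs, Subsingleton.elim s' s]
  · simp

/-- Conservation of message number for a single message: a contributing distribution fixes the word
lengths, namely 1 on one wire and 0 elsewhere. -/
theorem exists_oneMsg_of_symmFun_ne_zero {ψ : S → (Σ w, X w) → ℂ} {l : ∀ w, Word (X w)}
    (h : symmFun ψ l ≠ 0) : ∃ w x, l = fun w' => wordOf (oneMsg w x w') := by
  obtain ⟨d, -, hd⟩ := Finset.exists_ne_zero_of_sum_ne_zero h
  have hl := fun w => odot_ne_zero ((Finset.prod_ne_zero_iff.mp hd) w (Finset.mem_univ w))
  have h1 : (l (d default)).1 = 1 := by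
    rw [hl, Fintype.card_eq_one_iff]
    exact ⟨⟨default, rfl⟩, fun s => Subtype.ext (Unique.eq_default _)⟩
  obtain ⟨x, hx⟩ := exists_wordOf_some h1
  refine ⟨d default, x, funext fun w => ?_⟩
  by_cases hw : w = d default
  · subst hw
    rw [oneMsg_self, hx]
  · rw [oneMsg_of_ne x hw]
    apply eq_wordOf_none
    rw [hl, Fintype.card_eq_zero_iff]
    refine ⟨fun s => hw ?_⟩
    rw [← s.2, Unique.eq_default s.1]

end OneMessage

section Messagewise

variable {W W' : Type} [Fintype W] [DecidableEq W] [Fintype W'] [DecidableEq W'] {X : W → Type}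
  {Y : W' → Type} [∀ w, Fintype (X w)] [∀ w, DecidableEq (X w)] [∀ w, Finite (Y w)]
  (T : Matrix (Σ w, Y w) (Σ w, X w) ℂ)

/-- On a state with a single message the wire that carries it is unique. -/
abbrev uniqueOneMsg (w : W) (x : X w) : Unique {w' : W // (oneMsg w x w').isSome = true} where
  default := ⟨w, by simp [oneMsg_self]⟩
  uniq := by
    rintro ⟨w', h⟩
    by_contra hne
    have hw : w' ≠ w := fun h' => hne (Subtype.ext h')
    simp [oneMsg_of_ne x hw] at h

theorem messagewise_oneMsg (w : W) (x : X w) (w' : W') (y : Y w') :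
    (messagewise T (EuclideanSpace.single (oneMsg w x) 1)).1 (fun v => wordOf (oneMsg w' y v))
      = T ⟨w', y⟩ ⟨w, x⟩ := by
  rw [messagewise, linExt_single, symm_apply]
  let := uniqueOneMsg w x
  rw [symmFun_oneMsg]
  change T _ ⟨w, (oneMsg w x w).get _⟩ = _
  simp [oneMsg_self]

theorem exists_oneMsg_of_messagewise_ne_zero {w : W} {x : X w} {l : ∀ w, Word (Y w)}
    (h : (messagewise T (EuclideanSpace.single (oneMsg w x) 1)).1 l ≠ 0) :
    ∃ w' y, l = fun v => wordOf (oneMsg w' y v) := by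
  rw [messagewise, linExt_single, symm_apply] at h
  let := uniqueOneMsg w x
  exact exists_oneMsg_of_symmFun_ne_zero h

end Messagewise

theorem sigma_eq_of_oneMsg_eq {W : Type} [DecidableEq W] {X : W → Type} {w w' : W} {x : X w}
    {x' : X w'} (h : oneMsg w x = oneMsg w' x') : (⟨w, x⟩ : Σ w, X w) = ⟨w', x'⟩ := by
  have hw : w = w' := by
    by_contra hne
    have h1 := congrFun h w
    rw [oneMsg_self, oneMsg_of_ne x' hne] at h1
    cases h1
  subst hw
  have h1 := congrFun h w
  rw [oneMsg_self, oneMsg_self, Option.some_inj] at h1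
  rw [h1]

theorem Iio_succ_eq_insert {m : ℕ} (j : Fin m) :
    Finset.Iio j.succ = insert j.castSucc (Finset.Iio j.castSucc) := by
  ext i
  simp only [Finset.mem_Iio, Finset.mem_insert, Fin.lt_def, Fin.ext_iff, Fin.val_succ,
    Fin.val_castSucc]
  omega

set_option synthInstance.maxSize 1000

/-! ### The amplitudes of single-message histories -/

theorem exists_eq_oneMsg_of_compatible {m : ℕ} {I O : Fin (m + 1) → Type}
    {R : Fin (m + 1) → Fin (m + 1) → Type} {n k : Fin (m + 1)}
    {x : InMsg I R n k} {o : ∀ k, Option (OutMsg O R n k)}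
    (h : ∀ w, SeqRep.Compatible (I := I) (wordOf (oneMsg k x w)) (o w)) :
    ∃ y : OutMsg O R n k, o = oneMsg k y ∧ y.1.2 = x.1.2 := by
  have hk := h k
  rw [oneMsg_self] at hk
  obtain ⟨y, hy⟩ : ∃ y, o k = some y := by
    rw [← Option.ne_none_iff_exists']
    intro h0
    exact absurd (hk.1.mpr h0) one_ne_zero
  refine ⟨y, funext fun w => ?_, hk.2 x y rfl hy⟩
  by_cases hw : w = k
  · subst hw
    rw [hy, oneMsg_self]
  · have h1 := h w
    rw [oneMsg_of_ne x hw] at h1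
    rw [oneMsg_of_ne y hw]
    exact h1.1.mp rfl

section Box

variable {m : ℕ} {P F : Type} {I O α : Fin (m + 1) → Type}
  [Fintype P] [DecidableEq P] [Fintype F]
  [∀ k, Fintype (I k)] [∀ k, Fintype (O k)] [∀ k, DecidableEq (O k)]
  [∀ n, Fintype (α n)] [∀ n, DecidableEq (α n)] (Q : QCQC m P F I O α)

theorem QCQC.sends_zero_apply (p : PastMsg P) (o : ∀ n k, Option (OutMsg O (Aux α) n k))
    (l : ∀ k, Word (InMsg I (Aux α) 0 k)) :
    (Q.box.sends p o 0).1 l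
      = symmFun (fun (_ : Unit) (y : Σ k, InMsg I (Aux α) 0 k) => Q.opFirst ⟨y.1, y.2.1⟩ p.1) l := by
  change (Q.barFirst (EuclideanSpace.single p 1)).1 l = _
  rw [InternalOps.barFirst, linExt_single, symm_apply]

theorem QCQC.sends_succ (p : PastMsg P) (o : ∀ n k, Option (OutMsg O (Aux α) n k)) (j : Fin m) :
    Q.box.sends p o j.succ = messagewise
      (fun (y : Σ k, InMsg I (Aux α) j.succ k) (x : Σ k, OutMsg O (Aux α) j.castSucc k) =>
        Q.opMid j ⟨y.1, y.2.1⟩ ⟨x.1, x.2.1⟩) (EuclideanSpace.single (o j.castSucc) 1) := rfl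

theorem QCQC.sends_zero_oneMsg (p : PastMsg P) (o : ∀ n k, Option (OutMsg O (Aux α) n k))
    (k : Fin (m + 1)) (x : InMsg I (Aux α) 0 k) :
    (Q.box.sends p o 0).1 (fun w => wordOf (oneMsg k x w)) = Q.opFirst ⟨k, x.1⟩ p.1 := by
  rw [Q.sends_zero_apply, symmFun_oneMsg]

theorem QCQC.sends_succ_oneMsg (p : PastMsg P) {o : ∀ n k, Option (OutMsg O (Aux α) n k)}
    {j : Fin m} {k : Fin (m + 1)} {y : OutMsg O (Aux α) j.castSucc k}
    (ho : o j.castSucc = oneMsg k y) (k' : Fin (m + 1)) (x : InMsg I (Aux α) j.succ k') :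
    (Q.box.sends p o j.succ).1 (fun w => wordOf (oneMsg k' x w))
      = Q.opMid j ⟨k', x.1⟩ ⟨k, y.1⟩ := by
  rw [Q.sends_succ, ho]
  exact messagewise_oneMsg _ k y k' x

theorem QCQC.last_oneMsg (k : Fin (m + 1)) (y : OutMsg O (Aux α) (Fin.last m) k)
    (f : FutMsg m F) :
    (Q.box.last (EuclideanSpace.single (oneMsg k y) 1)).1 (fun _ => wordOf (some f))
      = Q.opLast f.1 ⟨k, y.1⟩ := by
  -- The future is a family of wires over `Unit`, so its message is a `oneMsg` state and
  -- `messagewise_oneMsg` applies.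
  have h : (fun _ : Unit => wordOf (some f))
      = fun v => wordOf (oneMsg (X := fun _ : Unit => FutMsg m F) () f v) := by
    funext v
    rw [oneMsg_self]
  rw [h]
  exact messagewise_oneMsg (fun (y : Σ _ : Unit, FutMsg m F)
    (x : Σ k, OutMsg O (Aux α) (Fin.last m) k) => Q.opLast y.2.1 ⟨x.1, x.2.1⟩) k y () f

/-- In every history of non-zero amplitude exactly one message travels at each step, and its control
system records the set of agents that have been visited before. -/
theorem QCQC.exists_history {p : PastMsg P} {l : ∀ n k, Word (InMsg I (Aux α) n k)}
    {o : ∀ n k, Option (OutMsg O (Aux α) n k)}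
    (hc : ∀ n k, SeqRep.Compatible (l n k) (o n k)) (hs : ∀ n, (Q.box.sends p o n).1 (l n) ≠ 0) :
    ∃ (k : Fin (m + 1) → Fin (m + 1)) (x : ∀ n, InMsg I (Aux α) n (k n))
      (y : ∀ n, OutMsg O (Aux α) n (k n)),
      (∀ n, l n = fun w => wordOf (oneMsg (k n) (x n) w)) ∧ (∀ n, o n = oneMsg (k n) (y n)) ∧
      (∀ n, (y n).1.2 = (x n).1.2) ∧ (∀ n, (x n).1.2.2.1 = (Finset.Iio n).image k) ∧
      Function.Bijective k := by
  have hstep : ∀ n, ∃ (k : Fin (m + 1)) (x : InMsg I (Aux α) n k) (y : OutMsg O (Aux α) n k),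
      (l n = fun w => wordOf (oneMsg k x w)) ∧ o n = oneMsg k y ∧ y.1.2 = x.1.2 := by
    -- The induction alternates: compatibility carries a single message through the agents, and
    -- non-zero amplitude carries it through the box.
    have hout : ∀ n, (∃ (k : Fin (m + 1)) (x : InMsg I (Aux α) n k),
        l n = fun w => wordOf (oneMsg k x w)) →
        ∃ (k : Fin (m + 1)) (x : InMsg I (Aux α) n k) (y : OutMsg O (Aux α) n k),
          (l n = fun w => wordOf (oneMsg k x w)) ∧ o n = oneMsg k y ∧ y.1.2 = x.1.2 := by
      rintro n ⟨k, x, hx⟩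
      obtain ⟨y, hy⟩ := exists_eq_oneMsg_of_compatible (x := x) (o := o n) (fun w => by
        have h := hc n w
        rwa [hx] at h)
      exact ⟨k, x, y, hx, hy⟩
    intro n
    induction n using Fin.induction with
    | zero =>
      have h := hs 0
      rw [Q.sends_zero_apply] at h
      exact hout 0 (exists_oneMsg_of_symmFun_ne_zero h)
    | succ j ih =>
      obtain ⟨k, x, y, -, hy, -⟩ := ih
      have h := hs j.succ
      rw [Q.sends_succ, hy] at h
      exact hout _ (exists_oneMsg_of_messagewise_ne_zero _ h)
  choose k x y hl ho hxy using hstep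
  -- The initial set has cardinality 0; afterwards `opMid` vanishes unless the new set is the old
  -- one with the last agent inserted.
  have hK : ∀ n, (x n).1.2.2.1 = (Finset.Iio n).image k := by
    intro n
    induction n using Fin.induction with
    | zero =>
      have h : (x 0).1.2.2.1 = ∅ := Finset.card_eq_zero.mp (x 0).1.2.2.2.1
      rw [h]
      rfl
    | succ j ih =>
      have h := hs j.succ
      rw [hl, Q.sends_succ_oneMsg p (ho j.castSucc)] at h
      unfold InternalOps.opMid at h
      rw [ite_ne_right_iff] at h
      rw [h.1]
      simp only
      rw [hxy, ih, Iio_succ_eq_insert, Finset.image_insert]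
  refine ⟨k, x, y, hl, ho, hxy, hK, Finite.injective_iff_bijective.mp ?_⟩
  -- The type `Ctrl` keeps `k j` out of the control set at step `j`, which by `hK` contains every
  -- earlier agent.
  have hne : ∀ i j, i < j → k i ≠ k j := by
    intro i j hij h
    refine (x j).1.2.2.2.2 ?_
    rw [hK, ← h]
    exact Finset.mem_image_of_mem k (Finset.mem_Iio.mpr hij)
  intro i j h
  by_contra hij
  rcases lt_or_gt_of_ne hij with hlt | hlt
  · exact hne i j hlt h
  · exact hne j i hlt h.symm

theorem QCQC.isProcessBox_box : Q.box.IsProcessBox := by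
  intro p l o hc hs a
  obtain ⟨k, x, -, hl, -, -, -, hk⟩ := Q.exists_history hc hs
  obtain ⟨n, rfl⟩ := hk.2 a
  rw [Finset.sum_eq_single n]
  · rw [hl]
    beta_reduce
    rw [oneMsg_self]
    rfl
  · intro n' _ hn
    rw [hl]
    beta_reduce
    rw [oneMsg_of_ne _ (hk.1.ne hn.symm)]
    rfl
  · simp

end Box

/-! ### Operational equivalence -/

theorem exists_isUnitary_dropTime (X : Type) [Fintype X] [DecidableEq X] (t : ℕ) :
    IsUnitary ((1 : Matrix X X ℂ).submatrix (Equiv.prodUnique X {s : ℕ // s = t}) id) := by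
  constructor
  · rw [Matrix.conjTranspose_submatrix, Matrix.submatrix_mul_equiv]
    simp
  · rw [Matrix.conjTranspose_submatrix, ← Equiv.coe_refl, Matrix.submatrix_mul_equiv,
      Matrix.conjTranspose_one, one_mul, Matrix.submatrix_one_equiv]

/-! ### Local operations on single-message histories. -/

section Local

variable {m : ℕ} {I O : Fin (m + 1) → Type} {R : Fin (m + 1) → Fin (m + 1) → Type}

theorem eff_oneMsg (σ : Equiv.Perm (Fin (m + 1)))
    (x : ∀ n, InMsg I R n (σ n)) (y : ∀ n, OutMsg O R n (σ n)) (k : Fin (m + 1)) :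
    SeqRep.Eff (k := k) (fun n => oneMsg (σ n) (x n) k) (fun n => oneMsg (σ n) (y n) k) := by
  obtain ⟨n, rfl⟩ := σ.surjective k
  refine ⟨n, fun n' hn => ?_, fun h => ?_⟩
  · exact ⟨oneMsg_of_ne _ (σ.injective.ne hn.symm), oneMsg_of_ne _ (σ.injective.ne hn.symm)⟩
  · simp [oneMsg_self] at h

variable [∀ n k, DecidableEq (R n k)]

theorem compatible_of_localSlot_ne_zero {n k : Fin (m + 1)} {A : Matrix (O k) (I k) ℂ}
    {i : Option (InMsg I R n k)} {o : Option (OutMsg O R n k)} (h : localSlot A n o i ≠ 0) :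
    SeqRep.Compatible (wordOf i) o := by
  rcases i with _ | x <;> rcases o with _ | y
  · refine ⟨by simp [wordOf], ?_⟩
    rintro x y - ⟨⟩
  · simp [localSlot] at h
  · simp [localSlot] at h
  · refine ⟨by simp [wordOf], ?_⟩
    rintro x' y' hx ⟨⟩
    have hx' := Option.some_injective _ (wordOf_injective hx)
    subst hx'
    simp only [localSlot, ne_eq, ite_eq_right_iff, Classical.not_imp] at h
    exact h.1

/-- Agent `σ n` sees a message only at step `n`; every other slot is vacuum to vacuum and
contributes a factor 1. -/
theorem prod_localSlot_oneMsg (A : ∀ k, Matrix (O k) (I k) ℂ) (σ : Equiv.Perm (Fin (m + 1)))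
    (x : ∀ n, InMsg I R n (σ n)) (y : ∀ n, OutMsg O R n (σ n)) (h : ∀ n, (y n).1.2 = (x n).1.2)
    (n : Fin (m + 1)) :
    ∏ n', localSlot (A (σ n)) n' (oneMsg (σ n') (y n') (σ n)) (oneMsg (σ n') (x n') (σ n))
      = A (σ n) (y n).1.1 (x n).1.1 := by
  rw [Finset.prod_eq_single n]
  · rw [oneMsg_self, oneMsg_self]
    exact if_pos (h n)
  · intro n' _ hn
    rw [oneMsg_of_ne _ (σ.injective.ne hn.symm), oneMsg_of_ne _ (σ.injective.ne hn.symm)]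
    rfl
  · simp

end Local

/-! ### Matching contributing histories with terms of the process vector. -/

section Equivalence

variable {m : ℕ} {P F : Type} {I O α : Fin (m + 1) → Type}

/-- The control state at step `n` when the agents act in the order `σ`. -/
def ctrlOf (σ : Equiv.Perm (Fin (m + 1))) (n : Fin (m + 1)) : Ctrl n (σ n) :=
  ⟨(Finset.Iio n).image σ, by
    rw [Finset.card_image_of_injective _ σ.injective, Fin.card_Iio], by simp⟩

/-- The message received at step `n` in the history with agent order `σ`, local basis states `z` and
ancilla basis states `a`. -/
def inMsgOf (z : ∀ k, I k × O k) (σ : Equiv.Perm (Fin (m + 1))) (a : ∀ n, α n)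
    (n : Fin (m + 1)) : InMsg I (Aux α) n (σ n) :=
  (((z (σ n)).1, a n, ctrlOf σ n), ⟨_, rfl⟩)

/-- The message sent after step `n` in the history with agent order `σ`, local basis states `z` and
ancilla basis states `a`. -/
def outMsgOf (z : ∀ k, I k × O k) (σ : Equiv.Perm (Fin (m + 1))) (a : ∀ n, α n)
    (n : Fin (m + 1)) : OutMsg O (Aux α) n (σ n) :=
  (((z (σ n)).2, a n, ctrlOf σ n), ⟨_, rfl⟩)

/-- The basis state of all the wires of the agents in a single-message history. -/
def historyOf (q : (∀ k, I k × O k) × Equiv.Perm (Fin (m + 1)) × (∀ n, α n)) (k : Fin (m + 1)) :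
    (∀ n, Option (InMsg I (Aux α) n k)) × (∀ n, Option (OutMsg O (Aux α) n k)) :=
  (fun n => oneMsg (q.2.1 n) (inMsgOf q.1 q.2.1 q.2.2 n) k,
    fun n => oneMsg (q.2.1 n) (outMsgOf q.1 q.2.1 q.2.2 n) k)

/-- The occupied wires reveal the order `σ`, and the messages on them reveal the ancilla and local
basis states. Surjectivity of `σ` recovers the latter for every agent. -/
theorem historyOf_injective : Function.Injective (historyOf (I := I) (O := O) (α := α)) := by
  rintro ⟨z, σ, a⟩ ⟨z', σ', a'⟩ h
  have h1 : ∀ n, (⟨σ n, inMsgOf z σ a n⟩ : Σ k, InMsg I (Aux α) n k) = ⟨σ' n, inMsgOf z' σ' a' n⟩ :=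
    fun n => sigma_eq_of_oneMsg_eq (funext fun k => congrFun (congrArg Prod.fst (congrFun h k)) n)
  have h2 : ∀ n, (⟨σ n, outMsgOf z σ a n⟩ : Σ k, OutMsg O (Aux α) n k)
      = ⟨σ' n, outMsgOf z' σ' a' n⟩ :=
    fun n => sigma_eq_of_oneMsg_eq (funext fun k => congrFun (congrArg Prod.snd (congrFun h k)) n)
  have hσ : σ = σ' := Equiv.ext fun n => congrArg Sigma.fst (h1 n)
  subst hσ
  simp only [Sigma.mk.injEq, heq_eq_eq, true_and] at h1 h2
  have ha : a = a' := funext fun n => congrArg (fun x => x.1.2.1) (h1 n)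
  have hz : z = z' := by
    funext k
    obtain ⟨n, rfl⟩ := σ.surjective k
    exact Prod.ext (congrArg (fun x => x.1.1) (h1 n)) (congrArg (fun x => x.1.1) (h2 n))
  rw [ha, hz]

/-- The contribution of one history to the process vector. -/
def InternalOps.pathAmplitude (Q : InternalOps m P F I O α) (p : P) (f : F)
    (z : ∀ k, I k × O k) (σ : Equiv.Perm (Fin (m + 1))) (a : ∀ n, α n) : ℂ :=
  choiVec (Q.first (σ 0)) (p, ((z (σ 0)).1, a 0))
    * (∏ n : Fin m,
        choiVec (Q.mid n ((Finset.Iio n.castSucc).image σ) (σ n.castSucc) (σ n.succ))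
          (((z (σ n.castSucc)).2, a n.castSucc), ((z (σ n.succ)).1, a n.succ)))
    * choiVec (Q.last (σ (Fin.last m))) (((z (σ (Fin.last m))).2, a (Fin.last m)), f)

variable [Fintype P] [DecidableEq P] [Fintype F]
  [∀ k, Fintype (I k)] [∀ k, Fintype (O k)] [∀ k, DecidableEq (O k)]
  [∀ n, Fintype (α n)] [∀ n, DecidableEq (α n)] (Q : QCQC m P F I O α)

/-- On one message each box map acts as the QC-QC operator, and the control condition in `opMid`
holds because the set of past agents grows by `σ j.castSucc`. -/
theorem QCQC.effChoi_historyOf (p : PastMsg P) (f : FutMsg m F)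
    (q : (∀ k, I k × O k) × Equiv.Perm (Fin (m + 1)) × (∀ n, α n)) :
    Q.box.effChoi (historyOf q, (p, f)) = Q.pathAmplitude p.1 f.1 q.1 q.2.1 q.2.2 := by
  obtain ⟨z, σ, a⟩ := q
  refine (if_pos (eff_oneMsg σ (inMsgOf z σ a) (outMsgOf z σ a))).trans ?_
  change (∏ n, (Q.box.sends p (fun n => oneMsg (σ n) (outMsgOf z σ a n)) n).1
      (fun k => wordOf (oneMsg (σ n) (inMsgOf z σ a n) k)))
    * (Q.box.last (EuclideanSpace.single (oneMsg (σ (Fin.last m)) (outMsgOf z σ a (Fin.last m))) 1)).1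
      (fun _ => wordOf (some f)) = _
  rw [Q.last_oneMsg, Fin.prod_univ_succ, Q.sends_zero_oneMsg, InternalOps.pathAmplitude]
  congr 2
  refine Finset.prod_congr rfl fun j _ => ?_
  rw [Q.sends_succ_oneMsg p rfl]
  refine if_pos ?_
  change (Finset.Iio j.succ).image σ = insert (σ j.castSucc) ((Finset.Iio j.castSucc).image σ)
  rw [Iio_succ_eq_insert, Finset.image_insert]

/-- Guarantees that reindexing by `historyOf` loses no term of the box's link product: non-zero
local matrix elements give compatibility, so `QCQC.exists_history` applies. -/
theorem QCQC.exists_historyOf_eq {A : ∀ k, Matrix (O k) (I k) ℂ}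
    {Z : ∀ k, (∀ n, Option (InMsg I (Aux α) n k)) × (∀ n, Option (OutMsg O (Aux α) n k))}
    {p : PastMsg P} {f : FutMsg m F} (hA : ∀ k n, localSlot (A k) n ((Z k).2 n) ((Z k).1 n) ≠ 0)
    (hV : Q.box.effChoi (Z, (p, f)) ≠ 0) : ∃ q, historyOf q = Z := by
  replace hV : Q.box.choi p (fun n k => (Z k).2 n) (fun n k => wordOf ((Z k).1 n))
      (wordOf (some f)) ≠ 0 := fun h => hV (by simp [SeqRep.effChoi, h])
  have hs := Finset.prod_ne_zero_iff.mp (left_ne_zero_of_mul hV)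
  obtain ⟨k, x, y, hl, ho, hxy, hK, hk⟩ := Q.exists_history
    (fun n k => compatible_of_localSlot_ne_zero (hA k n)) (fun n => hs n (Finset.mem_univ n))
  let σ : Equiv.Perm (Fin (m + 1)) := Equiv.ofBijective k hk
  -- The local states are indexed by time in the history; transport along `σ` indexes them by agent.
  let z : ∀ k, I k × O k := Equiv.piCongrLeft (fun k => I k × O k) σ
    (fun n => ((x n).1.1, (y n).1.1))
  have hz : ∀ n, z (σ n) = ((x n).1.1, (y n).1.1) :=
    fun n => Equiv.piCongrLeft_apply_apply (fun k => I k × O k) σ _ n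
  have hctrl : ∀ n, ctrlOf σ n = (x n).1.2.2 := fun n => Subtype.ext (hK n).symm
  have hx : ∀ n, inMsgOf z σ (fun n => (x n).1.2.1) n = x n := by
    intro n
    refine Prod.ext (Prod.ext ?_ (Prod.ext rfl (hctrl n))) (Subsingleton.elim _ _)
    exact (congrArg Prod.fst (hz n) :)
  have hy : ∀ n, outMsgOf z σ (fun n => (x n).1.2.1) n = y n := by
    intro n
    refine Prod.ext (Prod.ext ?_ ?_) (Subsingleton.elim _ _)
    · exact (congrArg Prod.snd (hz n) :)
    · rw [hxy]
      exact Prod.ext rfl (hctrl n)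
  refine ⟨(z, σ, fun n => (x n).1.2.1), funext fun w => Prod.ext (funext fun n => ?_)
    (funext fun n => ?_)⟩
  · refine wordOf_injective (Eq.trans ?_ (congrFun (hl n) w).symm)
    change wordOf (oneMsg (k n) (inMsgOf z σ (fun n => (x n).1.2.1) n) w) = _
    rw [hx]
  · refine Eq.trans ?_ (congrFun (ho n) w).symm
    change oneMsg (k n) (outMsgOf z σ (fun n => (x n).1.2.1) n) w = _
    rw [hy]

theorem QCQC.link_processVector_eq (A : ∀ k, Matrix (O k) (I k) ℂ)
    (Abar : ∀ k, Matrix (∀ n, Option (OutMsg O (Aux α) n k)) (∀ n, Option (InMsg I (Aux α) n k)) ℂ)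
    (h : ∀ k, LocalEquiv (A k) (Abar k)) (p : PastMsg P) (f : FutMsg m F) :
    link (tensorChoi A) Q.processVector (p.1, f.1)
      = link (tensorChoi Abar) Q.box.effChoi (p, f) := by
  have h1 : link (tensorChoi A) Q.processVector (p.1, f.1)
      = ∑ q : (∀ k, I k × O k) × Equiv.Perm (Fin (m + 1)) × (∀ n, α n),
        tensorChoi A q.1 * Q.pathAmplitude p.1 f.1 q.1 q.2.1 q.2.2 := by
    rw [Fintype.sum_prod_type]
    refine Finset.sum_congr rfl fun z _ => ?_
    change _ = ∑ y : Equiv.Perm (Fin (m + 1)) × (∀ n, α n),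
      tensorChoi A z * Q.pathAmplitude p.1 f.1 z y.1 y.2
    rw [← Finset.mul_sum, Fintype.sum_prod_type]
    rfl
  rw [h1]
  -- What remains is that terms outside the image of `historyOf` vanish and that terms inside it
  -- agree.
  refine Finset.sum_of_injOn historyOf historyOf_injective.injOn (by simp) ?_ ?_
  · intro Z _ hZ
    by_contra h0
    have hA := left_ne_zero_of_mul h0
    simp only [tensorChoi, choiVec, h _ _ _, Finset.prod_ne_zero_iff, Finset.mem_univ,
      forall_true_left] at hA
    obtain ⟨q, hq⟩ := Q.exists_historyOf_eq hA (right_ne_zero_of_mul h0)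
    exact hZ ⟨q, by simp, hq⟩
  · rintro ⟨z, σ, a⟩ _
    rw [Q.effChoi_historyOf]
    congr 1
    refine Finset.prod_congr rfl fun k _ => ?_
    obtain ⟨n, rfl⟩ := σ.surjective k
    simp only [choiVec]
    rw [h]
    exact (prod_localSlot_oneMsg A σ (inMsgOf z σ a) (outMsgOf z σ a) (fun _ => rfl) n).symm

theorem QCQC.operationallyEquivalent_box [DecidableEq F] :
    OperationallyEquivalent Q.toInternalOps Q.box := by
  -- Both unitaries merely attach the fixed time stamp.
  refine ⟨_, _, exists_isUnitary_dropTime P 1, exists_isUnitary_dropTime F (2 * (m + 1) + 2), ?_⟩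
  intro A Abar h
  funext ⟨p, f⟩
  rw [← Q.link_processVector_eq A Abar h]
  simp [Matrix.mulVec, dotProduct, Fintype.sum_prod_type, Matrix.one_apply]

end Equivalence

end QCPB

theorem mainTheorem1 (m : ℕ) (P F : Type) (I O α : Fin (m + 1) → Type)
    [Fintype P] [DecidableEq P] [Fintype F] [DecidableEq F]
    [∀ k, Fintype (I k)] [∀ k, Fintype (O k)] [∀ k, DecidableEq (O k)]
    [∀ n, Fintype (α n)] [∀ n, DecidableEq (α n)]
    (Q : QCPB.QCQC m P F I O α) :
    ∃ B : QCPB.SeqRep m P F I O (QCPB.Aux α),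
      B.first.toLinearMap = Q.barFirst ∧
      (∀ n, (B.mid n).toLinearMap = Q.barMid n) ∧
      B.last.toLinearMap = Q.barLast ∧
      B.IsProcessBox ∧
      QCPB.OperationallyEquivalent Q.toInternalOps B :=
  ⟨Q.box, rfl, fun _ => rfl, rfl, Q.isProcessBox_box, Q.operationallyEquivalent_box⟩
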